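/- For a finite directed graph $D$, let $\Delta(D)$ be the simplicial complex whose vertices are the directed edges of $D$ and whose faces are the edge sets of the directed forests that are subgraphs of $D$. Here a directed tree with root $r$ is an acyclic directed graph in which every vertex $x$ is reached from $r$ by a unique directed path, and a directed forest is a family of vertex-disjoint directed trees. Let $n\ge 3$, and let $\overrightarrow{C}_n$ be the directed graph obtained from the cycle $C_n$ with $n$ vertices by replacing every edge $xy$ by the two directed edges $\overrightarrow{xy}$ and $\overrightarrow{yx}$. Write $\Delta^{(k)}$ for the $k$-skeleton of $\Delta=\Delta(\overrightarrow{C}_n)$, consisting of all faces of dimension at most $k$. A $d$-dimensional complex is pure if every face of dimension less than $d$ lies in a $d$-dimensional face. Let $m_{C_n}$ be the maximal dimension of a skeleton of $\Delta(\overrightarrow{C}_n)$ that is pure. A simplicial complex is shellable if it is pure and its maximal faces can be ordered $F_1,\dots,F_t$ so that for all $i<j\le t$ there are $l<j$ and a vertex $v\in F_j$ with $$F_i\cap F_j\subseteq F_l\cap F_j=F_j\setminus\{v\}.$$ **Theorem.** For every $n\ge 3$, the complex $\Delta^{(m_{C_n})}(\overrightarrow{C}_n)$ is shellable if and only if $n=3k$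 or $n=3k+1$ for some integer $k$. -/

import Mathlib

namespace TreeComplex

/-! ### Directed trees and directed forests

Directed graphs are given by their sets of edges; the pair `(x, y)` is the edge from `x` to `y`. -/

section Forests

variable {V : Type*}

/-- The list `p` of pairwise distinct vertices is a directed path from `x` to `y`
along edges in `E`. -/
structure IsDirectedPath (E : Set (V × V)) (x y : V) (p : List V) : Prop where
  head : p.head? = some x
  last : p.getLast? = some y
  chain : p.IsChain (fun a b => (a, b) ∈ E)
  nodup : p.Nodup

/-- There is no closed directed walk of positive length (in particular no loop and no pair of
opposite edges). -/
def IsAcyclic (E : Set (V × V)) : Prop :=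
  ∀ x, ¬ Relation.TransGen (fun a b => (a, b) ∈ E) x x

/-- The directed graph with vertex set `W` and edge set `E` is a directed tree with root `r`. -/
structure IsDirectedTree (W : Set V) (E : Set (V × V)) (r : V) : Prop where
  edge_mem : ∀ e ∈ E, e.1 ∈ W ∧ e.2 ∈ W
  acyclic : IsAcyclic E
  root_mem : r ∈ W
  existsUnique_path : ∀ x ∈ W, ∃! p : List V, IsDirectedPath E r x p

/-- `E` is the edge set of a directed forest, that is, of a family of (vertex-)disjoint
directed trees `(W, E')`. -/
def IsDirectedForest (E : Set (V × V)) : Prop :=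
  ∃ T : Set (Set V × Set (V × V)),
    (∀ t ∈ T, ∃ r, IsDirectedTree t.1 t.2 r) ∧
    T.PairwiseDisjoint Prod.fst ∧
    E = ⋃ t ∈ T, t.2

theorem IsDirectedForest.acyclic {E : Set (V × V)} (h : IsDirectedForest E) : IsAcyclic E := by
  obtain ⟨T, hT, hd, rfl⟩ := h
  have key : ∀ x y, Relation.TransGen (fun a b => (a, b) ∈ ⋃ t ∈ T, t.2) x y →
      ∀ t ∈ T, x ∈ t.1 → Relation.TransGen (fun a b => (a, b) ∈ t.2) x y ∧ y ∈ t.1 := by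
    have step : ∀ a b, (a, b) ∈ ⋃ t ∈ T, t.2 → ∀ t ∈ T, a ∈ t.1 → (a, b) ∈ t.2 ∧ b ∈ t.1 := by
      intro a b hab t ht hat
      simp only [Set.mem_iUnion, exists_prop] at hab
      obtain ⟨u, hu, hab⟩ := hab
      obtain ⟨r, hr⟩ := hT u hu
      have h1 := hr.edge_mem _ hab
      have : t = u := by
        by_contra hne
        exact Set.disjoint_left.1 (hd ht hu hne) hat h1.1
      subst this
      exact ⟨hab, h1.2⟩
    intro x y hxy t ht hxt
    induction hxy with
    | single h => exact ⟨.single (step _ _ h t ht hxt).1, (step _ _ h t ht hxt).2⟩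
    | tail _ h ih => exact ⟨.tail ih.1 (step _ _ h t ht ih.2).1, (step _ _ h t ht ih.2).2⟩
  intro x hx
  obtain ⟨b, hb, -⟩ := Relation.TransGen.head'_iff.1 hx
  simp only [Set.mem_iUnion, exists_prop] at hb
  obtain ⟨t, ht, hb⟩ := hb
  obtain ⟨r, hr⟩ := hT t ht
  exact hr.acyclic x (key x x hx t ht (hr.edge_mem _ hb).1).1

theorem reflTransGen_of_mem_isChain {R : V → V → Prop} :
    ∀ {p : List V} {x y : V}, p.IsChain R → p.getLast? = some y → x ∈ p →
      Relation.ReflTransGen R x y := by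
  intro p
  induction p with
  | nil => intro x y _ _ h; simp at h
  | cons a l ih =>
    intro x y hc hl hx
    cases l with
    | nil =>
      simp at hl hx
      subst hl; subst hx; exact .refl
    | cons b l =>
      rw [List.isChain_cons_cons] at hc
      have hl' : (b :: l).getLast? = some y := by simpa using hl
      rcases List.mem_cons.1 hx with rfl | hx
      · exact .head hc.1 (ih hc.2 hl' (by simp))
      · exact ih hc.2 hl' hx

theorem IsDirectedPath.concat {E : Set (V × V)} (hE : IsAcyclic E) {x y z : V} {p : List V}
    (h : IsDirectedPath E x y p) (hyz : (y, z) ∈ E) : IsDirectedPath E x z (p ++ [z]) where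
  head := by
    have := h.head
    cases p <;> simp_all
  last := by simp
  chain := by
    rw [List.isChain_append]
    refine ⟨h.chain, by simp, ?_⟩
    intro a ha b hb
    rw [h.last] at ha
    simp at ha hb
    subst ha; subst hb; exact hyz
  nodup := by
    refine List.nodup_append.2 ⟨h.nodup, by simp, ?_⟩
    intro a ha b hb hab
    simp at hb
    subst hb; subst hab
    exact hE a (Relation.TransGen.tail' (reflTransGen_of_mem_isChain h.chain h.last ha) hyz)

theorem IsDirectedForest.eq_of_mem {E : Set (V × V)} (h : IsDirectedForest E) {a a' b : V}
    (hab : (a, b) ∈ E) (hab' : (a', b) ∈ E) : a = a' := by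
  obtain ⟨T, hT, hd, rfl⟩ := h
  simp only [Set.mem_iUnion, exists_prop] at hab hab'
  obtain ⟨t, ht, hab⟩ := hab
  obtain ⟨u, hu, hab'⟩ := hab'
  obtain ⟨r, hr⟩ := hT t ht
  obtain ⟨s, hs⟩ := hT u hu
  have : t = u := by
    by_contra hne
    exact Set.disjoint_left.1 (hd ht hu hne) (hr.edge_mem _ hab).2 (hs.edge_mem _ hab').2
  subst this
  obtain ⟨p, hp, -⟩ := hr.existsUnique_path a (hr.edge_mem _ hab).1
  obtain ⟨p', hp', -⟩ := hr.existsUnique_path a' (hr.edge_mem _ hab').1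
  have := (hr.existsUnique_path b (hr.edge_mem _ hab).2).unique
    (hp.concat hr.acyclic hab) (hp'.concat hr.acyclic hab')
  have hpp : p = p' := by simpa using this
  have h1 := hp.last
  rw [hpp, hp'.last] at h1
  exact (Option.some.inj h1).symm

theorem IsDirectedPath.exists_of_reflTransGen {E : Set (V × V)} (hE : IsAcyclic E) {x y : V}
    (h : Relation.ReflTransGen (fun a b => (a, b) ∈ E) x y) : ∃ p, IsDirectedPath E x y p := by
  induction h with
  | refl => exact ⟨[x], by simp, by simp, by simp, by simp⟩
  | tail _ hbc ih =>
    obtain ⟨p, hp⟩ := ih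
    exact ⟨_, hp.concat hE hbc⟩

theorem IsDirectedPath.unique {E : Set (V × V)} (hin : ∀ a a' b, (a, b) ∈ E → (a', b) ∈ E → a = a')
    {r : V} (hr : ∀ a, (a, r) ∉ E) (p : List V) :
    ∀ {y : V} {q : List V}, IsDirectedPath E r y p → IsDirectedPath E r y q → p = q := by
  induction p using List.reverseRecOn with
  | nil => intro y q hp; simpa using hp.head
  | append_singleton p b ih =>
    intro y q hp hq
    obtain rfl : b = y := by simpa using hp.last
    rcases List.eq_nil_or_concat q with rfl | ⟨q, c, rfl⟩
    · simpa using hq.head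
    rw [List.concat_eq_append] at hq ⊢
    obtain rfl : c = b := by simpa using hq.last
    have aux : ∀ {l : List V}, IsDirectedPath E r c (l ++ [c]) →
        (l = [] ∧ c = r) ∨ ∃ a, (a, c) ∈ E ∧ IsDirectedPath E r a l := by
      intro l hl
      rcases List.eq_nil_or_concat l with rfl | ⟨l, a, rfl⟩
      · left; simpa using hl.head
      · rw [List.concat_eq_append] at hl ⊢
        right
        have hc := List.isChain_append.1 hl.chain
        refine ⟨a, hc.2.2 a (by simp) c (by simp), ?_, by simp, hc.1,
          (List.nodup_append.1 hl.nodup).1⟩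
        have := hl.head
        cases l <;> simp_all
    rcases aux hp with ⟨rfl, rfl⟩ | ⟨a, ha, hpa⟩ <;> rcases aux hq with ⟨rfl, h⟩ | ⟨a', ha', hqa⟩
    · rfl
    · exact absurd ha' (hr _)
    · exact absurd (h ▸ ha) (hr _)
    · obtain rfl := hin _ _ _ ha ha'
      rw [ih hpa hqa]

/-- On a finite vertex set, the directed forests are the acyclic directed graphs in which every
vertex has in-degree at most one. -/
theorem isDirectedForest_iff [Finite V] {E : Set (V × V)} :
    IsDirectedForest E ↔
      IsAcyclic E ∧ ∀ a a' b, (a, b) ∈ E → (a', b) ∈ E → a = a' := by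
  refine ⟨fun h => ⟨h.acyclic, fun a a' b => h.eq_of_mem⟩, fun ⟨hE, hin⟩ => ?_⟩
  let R : V → V → Prop := fun a b => (a, b) ∈ E
  let W : V → Set V := fun r => {x | Relation.ReflTransGen R r x}
  let F : V → Set (V × V) := fun r => {e | e ∈ E ∧ e.1 ∈ W r}
  have hF : ∀ r, IsAcyclic (F r) := fun r x hx =>
    hE x (Relation.TransGen.mono (fun a b h => h.1) x x hx)
  refine ⟨{t | ∃ r, (∀ a, (a, r) ∉ E) ∧ t = (W r, F r)}, ?_, ?_, ?_⟩
  · rintro _ ⟨r, hr, rfl⟩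
    refine ⟨r, ?_, hF r, .refl, ?_⟩
    · rintro ⟨a, b⟩ ⟨h1, h2⟩
      exact ⟨h2, Relation.ReflTransGen.tail h2 h1⟩
    · intro x hx
      have hx' : Relation.ReflTransGen (fun a b => (a, b) ∈ F r) r x := by
        change Relation.ReflTransGen R r x at hx
        induction hx with
        | refl => exact .refl
        | tail h1 h2 ih => exact ih.tail ⟨h2, h1⟩
      obtain ⟨p, hp⟩ := IsDirectedPath.exists_of_reflTransGen (hF r) hx'
      refine ⟨p, hp, fun q hq => ?_⟩
      exact IsDirectedPath.unique (fun a a' b h h' => hin a a' b h.1 h'.1)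
        (fun a h => hr a h.1) q hq hp
  · rintro _ ⟨r, hr, rfl⟩ _ ⟨s, hs, rfl⟩ hne
    refine Set.disjoint_left.2 fun x (hx : Relation.ReflTransGen R r x)
      (hx' : Relation.ReflTransGen R s x) => hne ?_
    suffices h : r = s by rw [h]
    have hx1 := Relation.reflTransGen_swap.2 hx
    have hx2 := Relation.reflTransGen_swap.2 hx'
    have hroot : ∀ {u v : V}, (∀ a, (a, v) ∉ E) → Relation.ReflTransGen R u v → u = v := by
      intro u v hv huv
      rcases Relation.ReflTransGen.cases_tail huv with h | ⟨c, -, hc⟩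
      · exact h.symm
      · exact absurd hc (hv c)
    rcases Relation.ReflTransGen.total_of_right_unique
      (fun b a a' h h' => hin a a' b h h') hx1 hx2 with h | h
    · exact (hroot hr (Relation.reflTransGen_swap.1 h)).symm
    · exact hroot hs (Relation.reflTransGen_swap.1 h)
  · have hwf : WellFounded (Relation.TransGen R) := by
      have : Std.Irrefl (Relation.TransGen R) := ⟨hE⟩
      exact Finite.wellFounded_of_trans_of_irrefl _
    have hroot : ∀ x, ∃ r, (∀ a, (a, r) ∉ E) ∧ x ∈ W r := by
      intro x
      induction x using hwf.induction with
      | _ x ih =>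
        by_cases h : ∀ a, (a, x) ∉ E
        · exact ⟨x, h, .refl⟩
        · push Not at h
          obtain ⟨a, ha⟩ := h
          obtain ⟨r, hr, har⟩ := ih a (.single ha)
          exact ⟨r, hr, Relation.ReflTransGen.tail har ha⟩
    ext ⟨a, b⟩
    simp only [Set.mem_iUnion, exists_prop]
    constructor
    · intro hab
      obtain ⟨r, hr, ha⟩ := hroot a
      exact ⟨_, ⟨r, hr, rfl⟩, hab, ha⟩
    · rintro ⟨_, ⟨r, hr, rfl⟩, h, -⟩
      exact h

/-- The edges of a subgraph of a directed forest form a directed forest. -/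
theorem IsDirectedForest.mono [Finite V] {E E' : Set (V × V)} (h : IsDirectedForest E)
    (hE : E' ⊆ E) : IsDirectedForest E' := by
  rw [isDirectedForest_iff] at h ⊢
  exact ⟨fun x hx => h.1 x (Relation.TransGen.mono (fun a b hab => hE hab) x x hx),
    fun a a' b hab hab' => h.2 a a' b (hE hab) (hE hab')⟩

end Forests

/-! ### Simplicial complexes

A `PreAbstractSimplicialComplex ι` is Mathlib's abstract simplicial complex: a family of nonempty
finite subsets of `ι` closed under passing to nonempty subsets. Its vertices are the `v` for which
`{v}` is a face. A face with `d + 1` elements has dimension `d`. -/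

section Complexes

variable {ι : Type*}

/-- The `k`-skeleton: all faces of dimension at most `k`. -/
def skeleton (K : PreAbstractSimplicialComplex ι) (k : ℕ) : PreAbstractSimplicialComplex ι where
  faces := {s | s ∈ K.faces ∧ s.card ≤ k + 1}
  isRelLowerSet_faces := fun _ hs =>
    ⟨(K.isRelLowerSet_faces hs.1).1, fun _ hts ht =>
      ⟨(K.isRelLowerSet_faces hs.1).2 hts ht, (Finset.card_le_card hts).trans hs.2⟩⟩

/-- The complex `K` is `d`-dimensional: `d` is the largest dimension of a face. -/
def HasDimension (K : PreAbstractSimplicialComplex ι) (d : ℕ) : Prop :=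
  IsGreatest {i : ℕ | ∃ s ∈ K.faces, s.card = i + 1} d

/-- `K` is `d`-dimensional and every face of dimension less than `d` is contained in a
`d`-dimensional face. -/
def IsPureOfDimension (K : PreAbstractSimplicialComplex ι) (d : ℕ) : Prop :=
  HasDimension K d ∧
    ∀ s ∈ K.faces, s.card < d + 1 → ∃ t ∈ K.faces, s ⊆ t ∧ t.card = d + 1

/-- A complex is pure if it is empty or pure of some dimension. -/
def IsPure (K : PreAbstractSimplicialComplex ι) : Prop :=
  K.faces = ∅ ∨ ∃ d, IsPureOfDimension K d

/-- A facet is an inclusion-maximal face. -/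
def IsFacet (K : PreAbstractSimplicialComplex ι) (s : Finset ι) : Prop :=
  Maximal (fun t => t ∈ K.faces) s

/-- `K` is pure, and its facets can be listed without repetition as `F 0, …, F (m - 1)` such that
for all `i < j` there are `l < j` and `v ∈ F j` with `F i ∩ F j ⊆ F l ∩ F j = F j \ {v}`. -/
def IsShellable [DecidableEq ι] (K : PreAbstractSimplicialComplex ι) : Prop :=
  IsPure K ∧
    ∃ (m : ℕ) (F : Fin m → Finset ι), Function.Injective F ∧
      (∀ s, IsFacet K s ↔ ∃ i, F i = s) ∧
      ∀ i j : Fin m, i < j → ∃ l : Fin m, l < j ∧ ∃ v ∈ F j,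
        F i ∩ F j ⊆ F l ∩ F j ∧ F l ∩ F j = F j \ {v}

/-- The maximal dimension of a skeleton of `K` that is pure. -/
noncomputable def maxPureSkeletonDim (K : PreAbstractSimplicialComplex ι) : ℕ :=
  sSup {d : ℕ | ∃ k : ℕ, IsPureOfDimension (skeleton K k) d}

/-- For a nonempty finite complex the supremum defining `maxPureSkeletonDim` is a maximum. -/
theorem isGreatest_maxPureSkeletonDim [Finite ι] (K : PreAbstractSimplicialComplex ι)
    (hK : K.faces.Nonempty) :
    IsGreatest {d : ℕ | ∃ k : ℕ, IsPureOfDimension (skeleton K k) d} (maxPureSkeletonDim K) := by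
  have := Fintype.ofFinite ι
  have hne : {d : ℕ | ∃ k : ℕ, IsPureOfDimension (skeleton K k) d}.Nonempty := by
    obtain ⟨s, hs⟩ := hK
    obtain ⟨v, hv⟩ := (K.isRelLowerSet_faces hs).1
    have hv' : {v} ∈ K.faces :=
      (K.isRelLowerSet_faces hs).2 (Finset.singleton_subset_iff.2 hv) (Finset.singleton_nonempty v)
    refine ⟨0, 0, ⟨⟨{v}, ⟨hv', by simp⟩, by simp⟩, ?_⟩, ?_⟩
    · rintro i ⟨t, ht, hi⟩
      have := ht.2
      omega
    · intro t ht h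
      have := ((skeleton K 0).isRelLowerSet_faces ht).1.card_pos
      omega
  have hbd : BddAbove {d : ℕ | ∃ k : ℕ, IsPureOfDimension (skeleton K k) d} := by
    refine ⟨Fintype.card ι, ?_⟩
    rintro d ⟨k, ⟨⟨s, -, hs⟩, -⟩, -⟩
    have := s.card_le_univ
    omega
  exact ⟨Nat.sSup_mem hne hbd, fun d hd => le_csSup hbd hd⟩

end Complexes

/-! ### The complex of directed trees -/

/-- The complex of directed trees of a finite directed graph `D`: its vertices are edges of `D`, and
its faces are the (nonempty) edge sets of directed forests that are subgraphs of `D`. -/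
def directedTreeComplex {V : Type*} [Finite V] (D : Digraph V) :
    PreAbstractSimplicialComplex (V × V) where
  faces := {s | s.Nonempty ∧ (∀ e ∈ s, D.Adj e.1 e.2) ∧ IsDirectedForest (s : Set (V × V))}
  isRelLowerSet_faces := fun _ hs =>
    ⟨hs.1, fun _ hts ht =>
      ⟨ht, fun e he => hs.2.1 e (hts he), hs.2.2.mono (Finset.coe_subset.2 hts)⟩⟩

/-- The directed graph obtained from a simple graph by replacing every edge `xy` by the two
directed edges from `x` to `y` and from `y` to `x`. -/
def doubleDigraph {V : Type*} (G : SimpleGraph V) : Digraph V where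
  Adj := G.Adj

end TreeComplex

/-!
List the `2n` arcs of the doubled cycle so that cyclically consecutive arcs have the same head or
are opposite. A set of fewer than `n` arcs is then a directed forest if and only if it is an
independent set of the cycle `C_{2n}`, since a directed closed walk without opposite arcs would go
around the whole cycle. The smallest facets have `⌈2n/3⌉` arcs, so the question is whether the
independent sets of size `⌈N/3⌉` in `C_N`, for `N = 2n`, form the facets of a shellable complex.

Write `⌈N/3⌉ = t + 1`. If `3t + 2 ≤ N`, deleting a vertex of `C_N`, or a vertex and its neighbours,
leaves a chordal graph, and the skeleta of the independence complex of a chordal graph are shellable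
by induction on the number of vertices. The two families can be combined because an independent set
of `t` vertices that avoids the closed neighbourhood of the deleted vertex dominates at most `3t`
vertices, hence can be extended without that vertex. If `N = 3t + 1`, a shellable complex with
facets of size `t + 1` would have no reduced cohomology in degree `t - 1`, but the sum of the
indicators of the `t + 1` sets `{1, 4, …, 3i - 2} ∪ {3i + 3, …, 3t}` is a cocycle that takes the
value one on a cross-polytope, the join of the pairs `{3i + 1, 3i + 2}`.
-/

namespace TreeComplex

section ShellableFamilies

variable {α β : Type*} [DecidableEq α] [DecidableEq β]
  {𝓐 𝓕 𝓛 : Set (Finset α)} {A B F : Finset α} {v : α}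

/-- The condition that a shelling imposes on the next facet `F` after the facets in `𝓕`. The
defining formula `A ∩ F ⊆ B ∩ F = F \ {v}` with `v ∈ F` is encoded as `v ∉ A` and
`F \ B = {v}`. -/
def Attaches (𝓕 : Set (Finset α)) (F : Finset α) : Prop :=
  ∀ A ∈ 𝓕, ∃ v ∉ A, ∃ B ∈ 𝓕, F \ B = {v}

/-- A finite family of finite sets whose members can be listed in a shelling order. -/
inductive IsShellableFamily : Set (Finset α) → Prop
  | empty : IsShellableFamily ∅
  | insert {𝓕 : Set (Finset α)} {F : Finset α} :
      IsShellableFamily 𝓕 → Attaches 𝓕 F → IsShellableFamily (insert F 𝓕)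

theorem inter_subset_and_inter_eq_sdiff_singleton_iff :
    v ∈ F ∧ A ∩ F ⊆ B ∩ F ∧ B ∩ F = F \ {v} ↔ v ∉ A ∧ F \ B = {v} := by
  simp only [Finset.ext_iff, Finset.subset_iff, Finset.mem_inter, Finset.mem_sdiff,
    Finset.mem_singleton]
  grind

theorem Attaches.notMem (h : Attaches 𝓕 F) : F ∉ 𝓕 := fun hF => by
  obtain ⟨v, hv, B, -, hB⟩ := h F hF
  exact hv (Finset.mem_sdiff.1 (hB ▸ Finset.mem_singleton_self v)).1

theorem isShellableFamily_of_subsingleton (h : 𝓕.Subsingleton) : IsShellableFamily 𝓕 := by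
  obtain rfl | ⟨F, rfl⟩ := h.eq_empty_or_singleton
  · exact .empty
  · simpa using IsShellableFamily.empty.insert (F := F) (fun A hA => hA.elim)

theorem range_eq_insert_range_castSucc {γ : Type*} {m : ℕ} (F : Fin (m + 1) → γ) :
    Set.range F = insert (F (Fin.last m)) (Set.range (F ∘ Fin.castSucc)) := by
  ext s
  simp only [Set.mem_range, Set.mem_insert_iff, Fin.exists_fin_succ', Function.comp_apply,
    or_comm, eq_comm]

theorem forall_attaches_image_Iio_succ_iff {m : ℕ} {F : Fin (m + 1) → Finset α} :
    (∀ j, Attaches (F '' Set.Iio j) (F j)) ↔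
      (∀ j, Attaches (F ∘ Fin.castSucc '' Set.Iio j) ((F ∘ Fin.castSucc) j)) ∧
        Attaches (Set.range (F ∘ Fin.castSucc)) (F (Fin.last m)) := by
  have image_Iio_last : F '' Set.Iio (Fin.last m) = Set.range (F ∘ Fin.castSucc) := by
    ext s
    simp only [Set.mem_image, Set.mem_Iio, Set.mem_range, Fin.exists_fin_succ',
      Fin.castSucc_lt_last, lt_irrefl, Function.comp_apply, true_and, false_and, or_false]
  simp only [Set.image_comp F, Fin.image_castSucc_Iio, Fin.forall_fin_succ', image_Iio_last]
  rfl

theorem isShellableFamily_iff_exists_range_eq :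
    IsShellableFamily 𝓕 ↔ ∃ (m : ℕ) (F : Fin m → Finset α),
      Set.range F = 𝓕 ∧ ∀ j, Attaches (F '' Set.Iio j) (F j) := by
  constructor
  · intro h
    induction h with
    | empty => exact ⟨0, Fin.elim0, Set.range_eq_empty _, fun j => j.elim0⟩
    | @insert _ G _ hG ih =>
      obtain ⟨m, F, rfl, hF⟩ := ih
      refine ⟨m + 1, Fin.snoc F G, ?_, forall_attaches_image_Iio_succ_iff.2 ?_⟩
      · rw [range_eq_insert_range_castSucc, Fin.snoc_comp_castSucc, Fin.snoc_last]
      · rw [Fin.snoc_comp_castSucc, Fin.snoc_last]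
        exact ⟨hF, hG⟩
  · rintro ⟨m, F, rfl, hF⟩
    induction m with
    | zero => exact Set.range_eq_empty F ▸ .empty
    | succ m ih =>
      obtain ⟨hinit, hlast⟩ := forall_attaches_image_Iio_succ_iff.1 hF
      exact range_eq_insert_range_castSucc F ▸ (ih _ hinit).insert hlast

theorem isShellableFamily_iff_exists_fin :
    IsShellableFamily 𝓕 ↔ ∃ (m : ℕ) (F : Fin m → Finset α), Function.Injective F ∧
      (∀ s, s ∈ 𝓕 ↔ ∃ i, F i = s) ∧
      ∀ i j : Fin m, i < j → ∃ l : Fin m, l < j ∧ ∃ v ∈ F j,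
        F i ∩ F j ⊆ F l ∩ F j ∧ F l ∩ F j = F j \ {v} := by
  constructor
  · intro h
    obtain ⟨m, F, rfl, hF⟩ := isShellableFamily_iff_exists_range_eq.1 h
    refine ⟨m, F, .of_lt_imp_ne fun i j hij heq =>
      (hF j).notMem (heq ▸ Set.mem_image_of_mem F hij), fun s => Iff.rfl, fun i j hij => ?_⟩
    obtain ⟨v, hv, _, ⟨l, hl, rfl⟩, hvl⟩ := hF j _ (Set.mem_image_of_mem F hij)
    exact ⟨l, hl, v, inter_subset_and_inter_eq_sdiff_singleton_iff.2 ⟨hv, hvl⟩⟩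
  · rintro ⟨m, F, -, hF, hshell⟩
    obtain rfl : Set.range F = 𝓕 := Set.ext fun s => (hF s).symm
    refine isShellableFamily_iff_exists_range_eq.2 ⟨m, F, rfl, fun j => ?_⟩
    rintro _ ⟨i, hij, rfl⟩
    obtain ⟨l, hl, v, hv⟩ := hshell i j hij
    have hv := inter_subset_and_inter_eq_sdiff_singleton_iff.1 hv
    exact ⟨v, hv.1, F l, Set.mem_image_of_mem F hl, hv.2⟩

theorem attaches_image_map_iff {f : α ↪ β} :
    Attaches (Finset.map f '' 𝓕) (F.map f) ↔ Attaches 𝓕 F := by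
  simp only [Attaches, Set.forall_mem_image, Set.exists_mem_image, ← Finset.map_sdiff]
  refine forall₂_congr fun A _ => ⟨?_, ?_⟩
  · rintro ⟨w, hw, B, hB, h⟩
    obtain ⟨v, -, rfl⟩ := Finset.mem_map.1 (h ▸ Finset.mem_singleton_self w)
    rw [← Finset.map_singleton, Finset.map_inj] at h
    exact ⟨v, by simpa using hw, B, hB, h⟩
  · rintro ⟨v, hv, B, hB, h⟩
    exact ⟨f v, by simpa using hv, B, hB, by rw [h, Finset.map_singleton]⟩

theorem IsShellableFamily.image_map (h : IsShellableFamily 𝓕) (f : α ↪ β) :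
    IsShellableFamily (Finset.map f '' 𝓕) := by
  induction h with
  | empty => simpa using empty
  | insert _ hF ih =>
    rw [Set.image_insert_eq]
    exact ih.insert (attaches_image_map_iff.2 hF)

theorem isShellableFamily_image_map_iff {f : α ↪ β} :
    IsShellableFamily (Finset.map f '' 𝓕) ↔ IsShellableFamily 𝓕 := by
  refine ⟨fun h => ?_, fun h => h.image_map f⟩
  generalize h𝓖 : Finset.map f '' 𝓕 = 𝓖 at h
  induction h generalizing 𝓕 with
  | empty => rw [Set.image_eq_empty.1 h𝓖]; exact .empty
  | @insert 𝓖 G _ hG ih =>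
    have injective_map := Finset.map_injective f
    obtain ⟨F, hF, rfl⟩ : G ∈ Finset.map f '' 𝓕 := h𝓖 ▸ Set.mem_insert G 𝓖
    have h𝓖' : Finset.map f '' (𝓕 \ {F}) = 𝓖 := by
      rw [Set.image_sdiff injective_map, h𝓖, Set.image_singleton,
        Set.insert_sdiff_self_of_notMem hG.notMem]
    rw [← Set.insert_sdiff_self_of_mem hF]
    exact (ih h𝓖').insert (attaches_image_map_iff.1 (h𝓖' ▸ hG))

theorem Attaches.union_image_insert (hF : Attaches 𝓛 F) (hv𝓐 : ∀ A ∈ 𝓐, v ∉ A) (hvF : v ∉ F)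
    (hext : ∃ B ∈ 𝓐, F ⊆ B) : Attaches (𝓐 ∪ insert v '' 𝓛) (insert v F) := by
  rintro _ (hA | ⟨A, hA, rfl⟩)
  · obtain ⟨B, hB, hFB⟩ := hext
    exact ⟨v, hv𝓐 _ hA, B, .inl hB, by
      rw [Finset.insert_sdiff_of_notMem _ (hv𝓐 B hB), Finset.sdiff_eq_empty_iff_subset.2 hFB,
        insert_empty_eq]⟩
  · obtain ⟨w, hw, B, hB, hFB⟩ := hF A hA
    have hwF : w ∈ F := (Finset.mem_sdiff.1 (hFB ▸ Finset.mem_singleton_self w)).1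
    refine ⟨w, by grind, insert v B, .inr (Set.mem_image_of_mem _ hB), ?_⟩
    rw [Finset.insert_sdiff_insert, Finset.sdiff_insert_of_notMem hvF, hFB]

theorem IsShellableFamily.union_image_insert (h𝓐 : IsShellableFamily 𝓐)
    (h𝓛 : IsShellableFamily 𝓛) (hv𝓐 : ∀ A ∈ 𝓐, v ∉ A) (hv𝓛 : ∀ F ∈ 𝓛, v ∉ F)
    (hext : ∀ F ∈ 𝓛, ∃ B ∈ 𝓐, F ⊆ B) : IsShellableFamily (𝓐 ∪ Insert.insert v '' 𝓛) := by
  induction h𝓛 with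
  | empty => simpa using h𝓐
  | insert _ hF ih =>
    simp only [Set.forall_mem_insert] at hv𝓛 hext
    rw [Set.image_insert_eq, Set.union_insert]
    exact (ih hv𝓛.2 hext.2).insert (hF.union_image_insert hv𝓐 hv𝓛.1 hext.1)

end ShellableFamilies

section IndependentSets

open SimpleGraph

variable {V : Type*} {G : SimpleGraph V} {S T U W : Finset V} {v w : V} {d s t : ℕ}

/-- The independent sets of `G` with `s` elements, all of them in `W`. -/
def indepSets (G : SimpleGraph V) (W : Finset V) (s : ℕ) : Set (Finset V) :=
  {S | S ⊆ W ∧ G.IsNIndepSet s S}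

/-- The subgraph of `G` induced on `W` is chordal. By a theorem of Dirac, this means that each
nonempty `U ⊆ W` has a vertex whose neighbours in `U` form a clique. -/
def IsChordalOn (G : SimpleGraph V) (W : Finset V) : Prop :=
  ∀ U ⊆ W, U.Nonempty → ∃ v ∈ U, G.IsClique {x | x ∈ U ∧ G.Adj v x}

theorem IsChordalOn.mono (hW : IsChordalOn G W) (hU : U ⊆ W) : IsChordalOn G U :=
  fun T hT => hW T (hT.trans hU)

variable [DecidableEq V]

theorem isIndepSet_insert_iff :
    G.IsIndepSet (insert v S : Finset V) ↔ G.IsIndepSet S ∧ ∀ u ∈ S, ¬G.Adj v u := by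
  rw [Finset.coe_insert, IsIndepSet, Set.pairwise_insert]
  refine and_congr_right fun _ => forall₂_congr fun u _ => ⟨fun h hvu => (h hvu.ne).1 hvu, ?_⟩
  exact fun h _ => ⟨h, mt Adj.symm h⟩

theorem indepSets_succ_eq_union [DecidableRel G.Adj] (hw : w ∈ W) :
    indepSets G W (s + 1) = indepSets G (W.erase w) (s + 1) ∪
      insert w '' indepSets G {u ∈ W.erase w | ¬G.Adj w u} s := by
  ext S
  simp only [indepSets, isNIndepSet_iff, Set.mem_union, Set.mem_image, Set.mem_ofPred_eq]
  constructor
  · rintro ⟨hSW, hS, hcard⟩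
    by_cases hwS : w ∈ S
    · rw [← Finset.insert_erase hwS, isIndepSet_insert_iff] at hS
      refine .inr ⟨S.erase w, ⟨fun u hu => ?_, hS.1, ?_⟩, Finset.insert_erase hwS⟩
      · exact Finset.mem_filter.2 ⟨Finset.erase_subset_erase w hSW hu, hS.2 u hu⟩
      · rw [Finset.card_erase_of_mem hwS, hcard, Nat.add_sub_cancel]
    · exact .inl ⟨Finset.subset_erase.2 ⟨hSW, hwS⟩, hS, hcard⟩
  · rintro (⟨hSW, hS⟩ | ⟨S, ⟨hSW, hS, hcard⟩, rfl⟩)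
    · exact ⟨hSW.trans (W.erase_subset w), hS⟩
    · simp only [Finset.subset_iff, Finset.mem_filter, Finset.mem_erase] at hSW
      refine ⟨Finset.insert_subset hw fun u hu => (hSW hu).1.2,
        isIndepSet_insert_iff.2 ⟨hS, fun u hu => (hSW hu).2⟩, ?_⟩
      rw [Finset.card_insert_of_notMem fun h => (hSW h).1.1 rfl, hcard]

theorem isShellableFamily_indepSets_succ [DecidableRel G.Adj] (hw : w ∈ W)
    (hdel : IsShellableFamily (indepSets G (W.erase w) (s + 1)))
    (hlink : IsShellableFamily (indepSets G {u ∈ W.erase w | ¬G.Adj w u} s))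
    (hext : ∀ F ∈ indepSets G {u ∈ W.erase w | ¬G.Adj w u} s,
      ∃ v ∈ W.erase w, v ∉ F ∧ G.IsIndepSet (insert v F : Finset V)) :
    IsShellableFamily (indepSets G W (s + 1)) := by
  rw [indepSets_succ_eq_union hw]
  refine hdel.union_image_insert hlink (fun S hS h => Finset.notMem_erase w W (hS.1 h))
    (fun F hF h => by simpa using hF.1 h) fun F hF => ?_
  obtain ⟨v, hv, hvF, hindep⟩ := hext F hF
  refine ⟨insert v F, ⟨Finset.insert_subset hv (hF.1.trans (Finset.filter_subset _ _)), hindep, ?_⟩,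
    Finset.subset_insert v F⟩
  rw [Finset.card_insert_of_notMem hvF, hF.2.card_eq]

theorem isShellableFamily_indepSets_zero : IsShellableFamily (indepSets G W 0) :=
  isShellableFamily_of_subsingleton fun S hS T hT => by
    rw [Finset.card_eq_zero.1 hS.2.card_eq, Finset.card_eq_zero.1 hT.2.card_eq]

theorem isShellableFamily_indepSets_of_isIndepSet (hW : G.IsIndepSet W) :
    IsShellableFamily (indepSets G W s) := by
  classical
  induction W using Finset.strongInduction generalizing s with | _ W ih
  rcases s with - | s
  · exact isShellableFamily_indepSets_zero
  by_cases hs : W.card ≤ s + 1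
  · refine isShellableFamily_of_subsingleton fun S hS T hT => ?_
    rw [Finset.eq_of_subset_of_card_le hS.1 (hS.2.card_eq ▸ hs),
      Finset.eq_of_subset_of_card_le hT.1 (hT.2.card_eq ▸ hs)]
  obtain ⟨w, hw⟩ : W.Nonempty := Finset.card_pos.1 (by omega)
  have hlt := Finset.erase_ssubset hw
  have hle := Finset.filter_subset (fun u => ¬G.Adj w u) (W.erase w)
  refine isShellableFamily_indepSets_succ hw (ih _ hlt (hW.mono hlt.1))
    (ih _ (hle.trans_ssubset hlt) (hW.mono (hle.trans hlt.1))) fun F hF => ?_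
  obtain ⟨v, hv, hvF⟩ := Finset.exists_mem_notMem_of_card_lt_card
    (show F.card < (W.erase w).card by rw [hF.2.card_eq, Finset.card_erase_of_mem hw]; omega)
  refine ⟨v, hv, hvF, hW.mono ?_⟩
  exact Finset.insert_subset (hlt.1 hv) (hF.1.trans (hle.trans hlt.1))

/-- Removing a neighbour `w` of a simplicial vertex `v` is a shedding step: an independent set that
avoids the closed neighbourhood of `w` can be enlarged by `v`. -/
theorem IsChordalOn.isShellableFamily_indepSets (hW : IsChordalOn G W) (s : ℕ) :
    IsShellableFamily (indepSets G W s) := by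
  classical
  induction W using Finset.strongInduction generalizing s with | _ W ih
  rcases s with - | s
  · exact isShellableFamily_indepSets_zero
  by_cases hindep : G.IsIndepSet W
  · exact isShellableFamily_indepSets_of_isIndepSet hindep
  let U : Finset V := {x ∈ W | ∃ y ∈ W, G.Adj x y}
  have hU : U.Nonempty := by
    simp only [IsIndepSet, Set.Pairwise, not_forall, not_not] at hindep
    obtain ⟨x, hx, y, hy, -, hxy⟩ := hindep
    exact ⟨x, Finset.mem_filter.2 ⟨hx, y, hy, hxy⟩⟩
  obtain ⟨v, hvU, hclique⟩ := hW U (Finset.filter_subset _ _) hU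
  obtain ⟨hvW, w, hwW, hvw⟩ := Finset.mem_filter.1 hvU
  have hlt := Finset.erase_ssubset hwW
  have hle := Finset.filter_subset (fun u => ¬G.Adj w u) (W.erase w)
  refine isShellableFamily_indepSets_succ hwW (ih _ hlt (hW.mono hlt.1) _)
    (ih _ (hle.trans_ssubset hlt) (hW.mono (hle.trans hlt.1)) _) fun F hF => ?_
  have hFW : ∀ u ∈ F, u ≠ w ∧ u ∈ W ∧ ¬G.Adj w u := fun u hu => by
    simpa only [Finset.mem_filter, Finset.mem_erase, and_assoc] using hF.1 hu
  refine ⟨v, Finset.mem_erase.2 ⟨hvw.ne, hvW⟩, fun hvF => (hFW v hvF).2.2 hvw.symm,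
    isIndepSet_insert_iff.2 ⟨hF.2.isIndepSet, fun u hu hvu => ?_⟩⟩
  obtain ⟨huw, huW, hwu⟩ := hFW u hu
  exact hwu (hclique ⟨Finset.mem_filter.2 ⟨hwW, v, hvW, hvw.symm⟩, hvw⟩
    ⟨Finset.mem_filter.2 ⟨huW, v, hvW, hvu.symm⟩, hvu⟩ huw.symm)

section Degree

variable [Fintype V] [DecidableRel G.Adj]

theorem exists_insert_isIndepSet_of_degree_le (hd : ∀ v, G.degree v ≤ d) (hS : G.IsIndepSet S)
    (hcard : (d + 1) * S.card + T.card < Fintype.card V) :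
    ∃ w, w ∉ S ∧ w ∉ T ∧ G.IsIndepSet (insert w S : Finset V) := by
  have card_lt : (S.biUnion (fun u => insert u (G.neighborFinset u)) ∪ T).card
      < (Finset.univ : Finset V).card := calc
    _ ≤ S.card * (d + 1) + T.card := (Finset.card_union_le _ _).trans <|
      Nat.add_le_add_right (Finset.card_biUnion_le_card_mul _ _ _ fun u _ =>
        (Finset.card_insert_le _ _).trans (Nat.succ_le_succ (hd u))) _
    _ < _ := by rwa [mul_comm, Finset.card_univ]
  obtain ⟨w, -, hw⟩ := Finset.exists_mem_notMem_of_card_lt_card card_lt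
  simp only [Finset.mem_union, Finset.mem_biUnion, Finset.mem_insert, mem_neighborFinset,
    not_or, not_exists, not_and] at hw
  exact ⟨w, fun h => (hw.1 w h).1 rfl, hw.2,
    isIndepSet_insert_iff.2 ⟨hS, fun u hu h => (hw.1 u hu).2 h.symm⟩⟩

theorem isShellableFamily_indepSets_univ_of_isChordalOn_erase
    (hv : IsChordalOn G (Finset.univ.erase v)) (hd : ∀ v, G.degree v ≤ d)
    (hcard : (d + 1) * t + 2 ≤ Fintype.card V) :
    IsShellableFamily (indepSets G Finset.univ (t + 1)) := by
  refine isShellableFamily_indepSets_succ (Finset.mem_univ v) (hv.isShellableFamily_indepSets _)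
    ((hv.mono (Finset.filter_subset _ _)).isShellableFamily_indepSets _) fun F hF => ?_
  obtain ⟨w, hwF, hwv, hindep⟩ := exists_insert_isIndepSet_of_degree_le (T := {v}) hd
    hF.2.isIndepSet (by rw [hF.2.card_eq, Finset.card_singleton]; omega)
  exact ⟨w, Finset.mem_erase.2 ⟨by simpa using hwv, Finset.mem_univ w⟩, hwF, hindep⟩

end Degree

end IndependentSets

section Cycles

open SimpleGraph

variable {n : ℕ}

theorem val_add_one_eq_ite [NeZero n] (hn : 2 ≤ n) (a : Fin n) :
    (a + 1).val = if a.val + 1 = n then 0 else a.val + 1 := by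
  obtain ⟨m, rfl⟩ := Nat.exists_eq_add_of_le' hn
  simp only [Fin.val_add_one, Fin.ext_iff, Fin.val_last, Nat.add_right_cancel_iff]

theorem cycleGraph_adj_iff_eq_add_one [NeZero n] (hn : 2 ≤ n) {a b : Fin n} :
    (cycleGraph n).Adj a b ↔ b = a + 1 ∨ a = b + 1 := by
  obtain ⟨m, rfl⟩ := Nat.exists_eq_add_of_le' hn
  rw [cycleGraph_adj, sub_eq_iff_eq_add', sub_eq_iff_eq_add', or_comm]

theorem cycleGraph_adj_iff_val (hn : 2 ≤ n) {a b : Fin n} :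
    (cycleGraph n).Adj a b ↔ b.val = (if a.val + 1 = n then 0 else a.val + 1) ∨
      a.val = if b.val + 1 = n then 0 else b.val + 1 := by
  have : NeZero n := ⟨by omega⟩
  rw [cycleGraph_adj_iff_eq_add_one hn, Fin.ext_iff, Fin.ext_iff, val_add_one_eq_ite hn,
    val_add_one_eq_ite hn]

theorem cycleGraph_degree_le_two (hn : 2 ≤ n) (a : Fin n) : (cycleGraph n).degree a ≤ 2 := by
  obtain ⟨m, rfl⟩ := Nat.exists_eq_add_of_le' hn
  rw [cycleGraph_degree_two_le]
  exact Finset.card_le_two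

theorem isChordalOn_cycleGraph_erase_zero [NeZero n] (hn : 2 ≤ n) :
    IsChordalOn (cycleGraph n) (Finset.univ.erase 0) := by
  intro U hU hne
  refine ⟨U.min' hne, U.min'_mem hne, Set.Subsingleton.pairwise ?_ _⟩
  suffices ∀ x ∈ U, (cycleGraph n).Adj (U.min' hne) x → x = U.min' hne + 1 from
    fun x hx y hy => (this x hx.1 hx.2).trans (this y hy.1 hy.2).symm
  intro x hxU hadj
  refine ((cycleGraph_adj_iff_eq_add_one hn).1 hadj).resolve_right fun hmin => ?_
  have hle : (x + 1).val ≤ x.val := hmin ▸ U.min'_le x hxU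
  have hne_zero : x + 1 ≠ 0 := hmin ▸ Finset.ne_of_mem_erase (hU (U.min'_mem hne))
  rw [Ne, Fin.ext_iff] at hne_zero
  simp only [val_add_one_eq_ite hn, Fin.val_zero] at hle hne_zero
  grind

theorem isShellableFamily_indepSets_cycleGraph {t : ℕ} (h : 3 * t + 2 ≤ n) :
    IsShellableFamily (indepSets (cycleGraph n) Finset.univ (t + 1)) := by
  have : NeZero n := ⟨by omega⟩
  have hn : 2 ≤ n := by omega
  exact isShellableFamily_indepSets_univ_of_isChordalOn_erase
    (isChordalOn_cycleGraph_erase_zero hn) (cycleGraph_degree_le_two hn)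
    (by rwa [Fintype.card_fin])

theorem exists_maximal_isIndepSet_cycleGraph (hn : 2 ≤ n) : ∃ S : Finset (Fin n),
    S.card = (n + 2) / 3 ∧ Maximal (fun S : Finset (Fin n) => (cycleGraph n).IsIndepSet S) S := by
  let f (i : Fin ((n + 2) / 3)) : Fin n := ⟨min (3 * i + 1) (n - 1), by omega⟩
  have hf : Function.Injective f := fun i j hij => Fin.ext (by
    have : min (3 * i.val + 1) (n - 1) = min (3 * j.val + 1) (n - 1) := congrArg Fin.val hij
    omega)
  have hindep : (cycleGraph n).IsIndepSet (Finset.univ.image f : Finset (Fin n)) := by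
    simp only [Finset.coe_image, Finset.coe_univ, Set.image_univ]
    rintro _ ⟨i, rfl⟩ _ ⟨j, rfl⟩ hij
    have : i.val ≠ j.val := fun h => hij (by rw [Fin.ext h])
    simp only [cycleGraph_adj_iff_val hn, f]
    split_ifs <;> omega
  refine ⟨Finset.univ.image f, by simp [Finset.card_image_of_injective _ hf], hindep,
    fun T hT hle x hx => ?_⟩
  have hx_mem : f ⟨x / 3, by omega⟩ ∈ T := hle (Finset.mem_image_of_mem f (Finset.mem_univ _))
  by_contra hx_notMem
  have hne : x ≠ f ⟨x / 3, by omega⟩ := fun h =>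
    hx_notMem (h ▸ Finset.mem_image_of_mem f (Finset.mem_univ _))
  refine hT hx hx_mem hne ?_
  rw [Ne, Fin.ext_iff] at hne
  rw [cycleGraph_adj_iff_val hn]
  simp only [f] at hne ⊢
  split_ifs <;> omega

end Cycles

section Cohomology

variable {α ι : Type*} [DecidableEq α] {𝓕 : Set (Finset α)} {E F : Finset α} {u : α} {t : ℕ}
  {b c : Finset α → ZMod 2}

/-- The simplicial coboundary modulo 2. A cochain is a function on all finite sets, of which only
the values on the faces of a given complex matter, and the empty set counts as a face. -/
def coboundary (c : Finset α → ZMod 2) (B : Finset α) : ZMod 2 :=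
  ∑ x ∈ B, c (B.erase x)

/-- The contracting homotopy of cochains on a cone with apex `u`. -/
def cone (u : α) (c : Finset α → ZMod 2) (E : Finset α) : ZMod 2 :=
  if u ∈ E then 0 else c (insert u E)

theorem coboundary_add : coboundary (b + c) E = coboundary b E + coboundary c E :=
  Finset.sum_add_distrib

theorem coboundary_congr (h : ∀ x ∈ E, b (E.erase x) = c (E.erase x)) :
    coboundary b E = coboundary c E :=
  Finset.sum_congr rfl h

theorem coboundary_coboundary : coboundary (coboundary c) E = 0 := by
  simp only [coboundary, Finset.sum_sigma']
  refine Finset.sum_involution (fun p _ => ⟨p.2, p.1⟩) (fun p _ => ?_) (fun p hp _ h => ?_)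
    (fun p hp => ?_) fun p _ => rfl
  · rw [Finset.erase_right_comm, CharTwo.add_self_eq_zero]
  · simp only [Finset.mem_sigma, Finset.mem_erase] at hp
    exact hp.2.1 (congrArg Sigma.fst h)
  · simp only [Finset.mem_sigma, Finset.mem_erase] at hp ⊢
    exact ⟨hp.2.2, hp.2.1.symm, hp.1⟩

theorem coboundary_cone_add_cone_coboundary :
    coboundary (cone u c) E + cone u (coboundary c) E = c E := by
  by_cases hu : u ∈ E
  · have cone_erase : ∀ x ∈ E, x ≠ u → cone u c (E.erase x) = 0 := fun x _ hx =>
      if_pos (Finset.mem_erase.2 ⟨hx.symm, hu⟩)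
    rw [coboundary, Finset.sum_eq_single_of_mem u hu cone_erase, cone, cone,
      if_neg (Finset.notMem_erase u E), if_pos hu, Finset.insert_erase hu, add_zero]
  · have cone_erase : ∀ x ∈ E, cone u c (E.erase x) = c ((insert u E).erase x) := fun x hx => by
      rw [cone, if_neg (mt Finset.mem_of_mem_erase hu),
        Finset.erase_insert_of_ne (ne_of_mem_of_not_mem hx hu).symm]
    rw [coboundary, Finset.sum_congr rfl cone_erase, cone, if_neg hu, coboundary,
      Finset.sum_insert hu, Finset.erase_insert hu, add_left_comm, CharTwo.add_self_eq_zero,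
      add_zero]

theorem coboundary_cone (h : u ∉ E → coboundary c (insert u E) = 0) :
    coboundary (cone u c) E = c E := by
  have cone_eq_zero : cone u (coboundary c) E = 0 := by
    rw [cone]; split_ifs with hu
    exacts [rfl, h hu]
  rw [← coboundary_cone_add_cone_coboundary (u := u) (c := c) (E := E), cone_eq_zero, add_zero]

theorem Attaches.exists_insert_mem_lowerClosure (hF : Attaches 𝓕 F) (ht : t < F.card) :
    ∃ u ∈ F, ∀ E ⊆ F, E ∈ lowerClosure 𝓕 → E.card < t → insert u E ∈ lowerClosure 𝓕 := by
  suffices ∃ u ∈ F, ∀ E ⊆ F, E ∈ lowerClosure 𝓕 → E.card < t →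
      ∃ v ∉ insert u E, F.erase v ∈ lowerClosure 𝓕 by
    obtain ⟨u, hu, h⟩ := this
    refine ⟨u, hu, fun E hEF hE hcard => ?_⟩
    obtain ⟨v, hv, hmem⟩ := h E hEF hE hcard
    exact (lowerClosure 𝓕).lower (Finset.subset_erase.2 ⟨Finset.insert_subset hu hEF, hv⟩) hmem
  by_cases hall : ∀ v ∈ F, F.erase v ∈ lowerClosure 𝓕
  · obtain ⟨u, hu⟩ : F.Nonempty := Finset.card_pos.1 (by omega)
    refine ⟨u, hu, fun E _ _ hcard => ?_⟩
    obtain ⟨v, hv, hvE⟩ := Finset.exists_mem_notMem_of_card_lt_card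
      (show (insert u E).card < F.card from ((Finset.card_insert_le u E).trans hcard).trans_lt ht)
    exact ⟨v, hvE, hall v hv⟩
  · push Not at hall
    obtain ⟨u, hu, hu_erase⟩ := hall
    refine ⟨u, hu, fun E _ hE _ => ?_⟩
    obtain ⟨A, hA, hEA⟩ := mem_lowerClosure.1 hE
    obtain ⟨v, hvA, B, hB, hFB⟩ := hF A hA
    have hmem : F.erase v ∈ lowerClosure 𝓕 := mem_lowerClosure.2 ⟨B, hB, by
      rw [← Finset.sdiff_singleton_eq_erase, ← hFB, sdiff_sdiff_right_self]
      exact inf_le_right⟩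
    refine ⟨v, ?_, hmem⟩
    rw [Finset.mem_insert, not_or]
    exact ⟨fun h => hu_erase (h ▸ hmem), fun h => hvA (hEA h)⟩

/-- Mayer–Vietoris: the primitives `b` on the old complex and `cone u c` on the new simplex differ
on the intersection by a cocycle, which is the coboundary of `cone u (b + cone u c)`. -/
theorem Attaches.exists_coboundary_eq_insert (hF : Attaches 𝓕 F) (ht : t < F.card)
    (hc : ∀ E ⊆ F, coboundary c E = 0)
    (hb : ∀ A ∈ lowerClosure 𝓕, A.card ≤ t → coboundary b A = c A) :
    ∃ b', ∀ A ∈ lowerClosure (insert F 𝓕), A.card ≤ t → coboundary b' A = c A := by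
  classical
  obtain ⟨u, hu, hu_insert⟩ := hF.exists_insert_mem_lowerClosure ht
  have coboundary_cone_eq : ∀ E ⊆ F, coboundary (cone u c) E = c E := fun E hE =>
    coboundary_cone fun _ => hc _ (Finset.insert_subset hu hE)
  set a := cone u (b + cone u c)
  have coboundary_a : ∀ E ⊆ F, E ∈ lowerClosure 𝓕 → E.card < t →
      coboundary a E = b E + cone u c E := fun E hEF hE hcard =>
    coboundary_cone fun _ => by
      rw [coboundary_add, coboundary_cone_eq _ (Finset.insert_subset hu hEF),
        hb _ (hu_insert E hEF hE hcard) ((Finset.card_insert_le u E).trans hcard),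
        CharTwo.add_self_eq_zero]
  refine ⟨fun E => if E ∈ lowerClosure 𝓕 then b E else cone u c E + coboundary a E,
    fun A hA hcard => ?_⟩
  by_cases hA𝓕 : A ∈ lowerClosure 𝓕
  · rw [← hb A hA𝓕 hcard]
    exact coboundary_congr fun x _ =>
      if_pos ((lowerClosure 𝓕).lower (Finset.erase_subset x A) hA𝓕)
  have hAF : A ⊆ F := by
    obtain ⟨B, rfl | hB, hAB⟩ := mem_lowerClosure.1 hA
    exacts [hAB, absurd (mem_lowerClosure.2 ⟨B, hB, hAB⟩) hA𝓕]
  calc _ = coboundary (cone u c + coboundary a) A := coboundary_congr fun x hx => by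
        split_ifs with hmem
        · rw [Pi.add_apply, coboundary_a _ ((A.erase_subset x).trans hAF) hmem
            ((Finset.card_erase_lt_of_mem hx).trans_le hcard), add_left_comm,
            CharTwo.add_self_eq_zero, add_zero]
        · rfl
    _ = c A := by
        rw [coboundary_add, coboundary_coboundary, add_zero, coboundary_cone_eq A hAF]

theorem IsShellableFamily.exists_coboundary_eq (h : IsShellableFamily 𝓕)
    (hcard : ∀ A ∈ 𝓕, t < A.card) (hc : ∀ A ∈ lowerClosure 𝓕, coboundary c A = 0) :
    ∃ b, ∀ A ∈ lowerClosure 𝓕, A.card ≤ t → coboundary b A = c A := by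
  induction h with
  | empty => exact ⟨0, by simp⟩
  | @insert 𝓕 F _ hF ih =>
    rw [Set.forall_mem_insert] at hcard
    have hle := lowerClosure_mono (Set.subset_insert F 𝓕)
    obtain ⟨b, hb⟩ := ih hcard.2 fun A hA => hc A (hle hA)
    exact hF.exists_coboundary_eq_insert hcard.1
      (fun E hE => hc E (mem_lowerClosure.2 ⟨F, Set.mem_insert F 𝓕, hE⟩)) hb

variable [Fintype ι]

/-- The facet of a cross-polytope with vertex pairs `v (i, false)`, `v (i, true)` that picks
`v (i, ε i)` from the `i`-th pair. -/
def crossFacet (v : ι × Bool → α) (ε : ι → Bool) : Finset α :=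
  Finset.univ.image fun i => v (i, ε i)

theorem sum_coboundary_crossFacet_eq_zero [DecidableEq ι] {v : ι × Bool → α}
    (hv : Function.Injective v) : ∑ ε : ι → Bool, coboundary b (crossFacet v ε) = 0 := by
  have hv_left (ε : ι → Bool) : Function.Injective fun i => v (i, ε i) := fun i j h =>
    congrArg Prod.fst (hv h)
  have erase_eq (ε : ι → Bool) (i : ι) : (crossFacet v ε).erase (v (i, ε i)) =
      (Finset.univ.erase i).image fun j => v (j, ε j) :=
    (Finset.image_erase (hv_left ε) Finset.univ i).symm
  have coboundary_eq (ε : ι → Bool) : coboundary b (crossFacet v ε) =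
      ∑ i, b ((Finset.univ.erase i).image fun j => v (j, ε j)) := by
    rw [coboundary, crossFacet, Finset.sum_image (hv_left ε).injOn]
    exact Finset.sum_congr rfl fun i _ => congrArg b (erase_eq ε i)
  simp only [coboundary_eq]
  rw [Finset.sum_comm]
  refine Finset.sum_eq_zero fun i _ => Finset.sum_involution
    (fun ε _ => Function.update ε i (!ε i)) (fun ε _ => ?_) (fun ε _ _ h => ?_)
    (fun ε _ => Finset.mem_univ _) fun ε _ => ?_
  · have image_update : (Finset.univ.erase i).image (fun j => v (j, Function.update ε i (!ε i) j)) =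
        (Finset.univ.erase i).image fun j => v (j, ε j) :=
      Finset.image_congr fun j hj => by
        simp only [Function.update_of_ne (Finset.ne_of_mem_erase hj)]
    rw [image_update, CharTwo.add_self_eq_zero]
  · simpa using congrFun h i
  · simp

end Cohomology

section CycleObstruction

open SimpleGraph

variable {t i : ℕ} {x : Fin (3 * t + 1)} {B : Finset (Fin (3 * t + 1))}

/-- The independent sets `{1, 4, …, 3i - 2} ∪ {3i + 3, 3i + 6, …, 3t}` of size `t` in the cycle on
`3t + 1` vertices; the sum of their indicators is a cocycle of the independence complex. -/
def shiftedSet (t i : ℕ) : Finset (Fin (3 * t + 1)) :=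
  {x | x.val < 3 * i ∧ x.val % 3 = 1 ∨ 3 * i < x.val ∧ x.val % 3 = 0}

/-- The sum of the indicators of the sets `shiftedSet t i` with `i ≤ t`. -/
def shiftedCochain (t : ℕ) (A : Finset (Fin (3 * t + 1))) : ZMod 2 :=
  ∑ i ∈ Finset.range (t + 1), if A = shiftedSet t i then 1 else 0

/-- The independent sets `shiftedSet t i ∪ {3i} = shiftedSet t (i - 1) ∪ {3i - 2}` of size
`t + 1`. -/
def shiftedFacet (t i : ℕ) : Finset (Fin (3 * t + 1)) :=
  {x | x.val < 3 * i ∧ x.val % 3 = 1 ∨ 3 * i ≤ x.val ∧ x.val % 3 = 0}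

theorem mem_shiftedSet :
    x ∈ shiftedSet t i ↔ x.val < 3 * i ∧ x.val % 3 = 1 ∨ 3 * i < x.val ∧ x.val % 3 = 0 :=
  Finset.mem_filter_univ x

theorem mem_shiftedFacet :
    x ∈ shiftedFacet t i ↔ x.val < 3 * i ∧ x.val % 3 = 1 ∨ 3 * i ≤ x.val ∧ x.val % 3 = 0 :=
  Finset.mem_filter_univ x

theorem val_eq_of_erase_eq_shiftedSet (hB : (cycleGraph (3 * t + 1)).IsIndepSet B) (hx : x ∈ B)
    (h : B.erase x = shiftedSet t i) (ht : 1 ≤ t) (hi : i ≤ t) :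
    1 ≤ i ∧ x.val = 3 * i ∨ i < t ∧ x.val = 3 * i + 1 := by
  have hx_notMem : x ∉ shiftedSet t i := h ▸ Finset.notMem_erase x B
  have not_neighbour (y : ℕ) (hy : y < 3 * t + 1)
      (hmem : y < 3 * i ∧ y % 3 = 1 ∨ 3 * i < y ∧ y % 3 = 0) :
      ¬(y = x.val + 1 ∨ x.val = y + 1 ∨ x.val = 0 ∧ y = 3 * t) := by
    have hyB : ⟨y, hy⟩ ∈ B.erase x := h ▸ mem_shiftedSet.2 hmem
    have not_adj : ¬(cycleGraph (3 * t + 1)).Adj x ⟨y, hy⟩ :=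
      hB hx (Finset.mem_of_mem_erase hyB) (Finset.ne_of_mem_erase hyB).symm
    rw [cycleGraph_adj_iff_val (by omega)] at not_adj
    dsimp only at not_adj
    split_ifs at not_adj <;> omega
  rw [mem_shiftedSet] at hx_notMem
  have hsucc := not_neighbour (x.val + 1)
  have hpred := not_neighbour (x.val - 1)
  have hlast := not_neighbour (3 * t)
  have := x.isLt
  omega

theorem erase_eq_shiftedSet_iff (hB : (cycleGraph (3 * t + 1)).IsIndepSet B) (hx : x ∈ B)
    (ht : 1 ≤ t) (hi : i ≤ t) :
    B.erase x = shiftedSet t i ↔ (1 ≤ i ∧ x.val = 3 * i ∧ B = shiftedFacet t i) ∨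
      (i < t ∧ x.val = 3 * i + 1 ∧ B = shiftedFacet t (i + 1)) := by
  constructor
  · intro h
    rw [← Finset.insert_erase hx, h]
    rcases val_eq_of_erase_eq_shiftedSet hB hx h ht hi with ⟨hi, hxi⟩ | ⟨hi, hxi⟩
    · refine .inl ⟨hi, hxi, Finset.ext fun y => ?_⟩
      rw [Finset.mem_insert, mem_shiftedSet, mem_shiftedFacet, Fin.ext_iff]
      omega
    · refine .inr ⟨hi, hxi, Finset.ext fun y => ?_⟩
      rw [Finset.mem_insert, mem_shiftedSet, mem_shiftedFacet, Fin.ext_iff]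
      omega
  · rintro (⟨_, hxi, rfl⟩ | ⟨_, hxi, rfl⟩)
    all_goals
      ext y
      rw [Finset.mem_erase, mem_shiftedSet, mem_shiftedFacet, Ne, Fin.ext_iff]
      omega

theorem sum_erase_eq_shiftedSet (hB : (cycleGraph (3 * t + 1)).IsIndepSet B) (ht : 1 ≤ t)
    (hi : i ≤ t) :
    (∑ x ∈ B, if B.erase x = shiftedSet t i then 1 else 0 : ZMod 2) =
      (if 1 ≤ i ∧ i ≤ t ∧ B = shiftedFacet t i then 1 else 0) +
        if 1 ≤ i + 1 ∧ i + 1 ≤ t ∧ B = shiftedFacet t (i + 1) then 1 else 0 := by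
  have sum_ite (P : Prop) [Decidable P] (y : ℕ) (hy : P → ∃ x ∈ B, x.val = y) :
      (∑ x ∈ B, if x.val = y ∧ P then 1 else 0 : ZMod 2) = if P then 1 else 0 := by
    split_ifs with hP
    · obtain ⟨x, hx, rfl⟩ := hy hP
      simp [hP, ← Fin.ext_iff, hx]
    · simp [hP]
  rw [← sum_ite _ (3 * i), ← sum_ite _ (3 * i + 1), ← Finset.sum_add_distrib]
  · refine Finset.sum_congr rfl fun x hx => ?_
    rw [if_congr (erase_eq_shiftedSet_iff hB hx ht hi) rfl rfl]
    split_ifs <;> grind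
  · rintro ⟨-, _, rfl⟩
    exact ⟨⟨3 * i + 1, by omega⟩, mem_shiftedFacet.2 (by simp only; omega), rfl⟩
  · rintro ⟨-, _, rfl⟩
    exact ⟨⟨3 * i, by omega⟩, mem_shiftedFacet.2 (by simp only; omega), rfl⟩

theorem coboundary_shiftedCochain (hB : (cycleGraph (3 * t + 1)).IsIndepSet B) (ht : 1 ≤ t) :
    coboundary (shiftedCochain t) B = 0 := by
  simp only [coboundary, shiftedCochain]
  rw [Finset.sum_comm, Finset.sum_congr rfl fun i hi =>
    sum_erase_eq_shiftedSet hB ht (Finset.mem_range_succ_iff.1 hi)]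
  simp only [← CharTwo.sub_eq_add]
  rw [Finset.sum_range_sub']
  simp

/-- The vertices `3i + 1` and `3i + 2` of the cycle on `3t + 1` vertices, as the `i`-th pair of
opposite vertices of a cross-polytope in the independence complex. -/
def crossVertex (t : ℕ) (p : Fin t × Bool) : Fin (3 * t + 1) :=
  ⟨3 * p.1 + 1 + p.2.toNat, by have := p.1.isLt; have := p.2.toNat_le; omega⟩

theorem crossVertex_injective : Function.Injective (crossVertex t) := by
  rintro ⟨i, b⟩ ⟨j, c⟩ h
  have h : 3 * i.val + 1 + b.toNat = 3 * j.val + 1 + c.toNat := congrArg Fin.val h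
  rw [Prod.mk.injEq, Fin.ext_iff]
  cases b <;> cases c <;> simp only [Bool.toNat_false, Bool.toNat_true] at h <;> grind

theorem isNIndepSet_crossFacet_crossVertex (ε : Fin t → Bool) :
    (cycleGraph (3 * t + 1)).IsNIndepSet t (crossFacet (crossVertex t) ε) where
  isIndepSet x hx y hy hxy := by
    rw [crossFacet, Finset.mem_coe, Finset.mem_image] at hx hy
    obtain ⟨i, -, rfl⟩ := hx
    obtain ⟨j, -, rfl⟩ := hy
    have hij : i.val ≠ j.val := fun h => hxy (by rw [Fin.ext h])
    have := (ε i).toNat_le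
    have := (ε j).toNat_le
    simp only [cycleGraph_adj_iff_val (show 2 ≤ 3 * t + 1 by have := i.isLt; omega), crossVertex]
    split_ifs <;> omega
  card_eq := by
    rw [crossFacet, Finset.card_image_of_injective, Finset.card_univ, Fintype.card_fin]
    exact fun i j h => congrArg Prod.fst (crossVertex_injective h)

theorem crossFacet_crossVertex_mem_lowerClosure (ht : 1 ≤ t) (ε : Fin t → Bool) :
    crossFacet (crossVertex t) ε ∈
      lowerClosure (indepSets (cycleGraph (3 * t + 1)) Finset.univ (t + 1)) := by
  have hε := isNIndepSet_crossFacet_crossVertex ε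
  obtain ⟨w, hw, -, h_insert⟩ := exists_insert_isIndepSet_of_degree_le (T := ∅)
    (cycleGraph_degree_le_two (show 2 ≤ 3 * t + 1 by omega)) hε.isIndepSet
    (by rw [hε.card_eq, Finset.card_empty, Fintype.card_fin]; omega)
  exact mem_lowerClosure.2 ⟨_, ⟨Finset.subset_univ _,
    ⟨h_insert, by rw [Finset.card_insert_of_notMem hw, hε.card_eq]⟩⟩,
    Finset.subset_insert _ _⟩

theorem shiftedCochain_crossFacet_crossVertex (ε : Fin t → Bool) :
    shiftedCochain t (crossFacet (crossVertex t) ε) = if ε = fun _ => false then 1 else 0 := by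
  have mem_crossFacet (x : Fin (3 * t + 1)) : x ∈ crossFacet (crossVertex t) ε ↔
      ∃ i, 3 * i.val + 1 + (ε i).toNat = x.val := by
    simp [crossFacet, crossVertex, Fin.ext_iff]
  have ne_shiftedSet : ∀ i ∈ Finset.range t, crossFacet (crossVertex t) ε ≠ shiftedSet t i := by
    intro i hi h
    have hlast : Fin.last (3 * t) ∈ shiftedSet t i :=
      mem_shiftedSet.2 (by rw [Fin.val_last]; have := Finset.mem_range.1 hi; omega)
    obtain ⟨j, hj⟩ := (mem_crossFacet _).1 (h ▸ hlast)
    have := (ε j).toNat_le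
    have := j.isLt
    rw [Fin.val_last] at hj
    omega
  have eq_shiftedSet_iff : crossFacet (crossVertex t) ε = shiftedSet t t ↔ ε = fun _ => false := by
    simp only [Finset.ext_iff, mem_crossFacet, mem_shiftedSet, funext_iff]
    refine ⟨fun h i => ?_, fun h x => ⟨?_, fun hx => ⟨⟨x.val / 3, by omega⟩, ?_⟩⟩⟩
    · have := (h (crossVertex t (i, ε i))).1 ⟨i, rfl⟩
      simp only [crossVertex] at this
      exact Bool.toNat_eq_zero.1 (by have := (ε i).toNat_le; omega)
    · rintro ⟨i, hi⟩
      rw [h, Bool.toNat_false] at hi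
      omega
    · rw [h, Bool.toNat_false]
      dsimp only
      omega
  rw [shiftedCochain, Finset.sum_range_succ, Finset.sum_eq_zero fun i hi =>
    if_neg (ne_shiftedSet i hi), zero_add, if_congr eq_shiftedSet_iff rfl rfl]

theorem not_isShellableFamily_indepSets_cycleGraph (ht : 1 ≤ t) :
    ¬IsShellableFamily (indepSets (cycleGraph (3 * t + 1)) Finset.univ (t + 1)) := by
  intro h
  obtain ⟨b, hb⟩ := h.exists_coboundary_eq (t := t) (c := shiftedCochain t)
    (fun A hA => by rw [hA.2.card_eq]; exact t.lt_succ_self) fun A hA => by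
      obtain ⟨B, hB, hAB⟩ := mem_lowerClosure.1 hA
      exact coboundary_shiftedCochain (hB.2.isIndepSet.mono hAB) ht
  have hsum := sum_coboundary_crossFacet_eq_zero (b := b) (crossVertex_injective (t := t))
  simp only [hb _ (crossFacet_crossVertex_mem_lowerClosure ht _)
    (isNIndepSet_crossFacet_crossVertex _).card_eq.le,
    shiftedCochain_crossFacet_crossVertex] at hsum
  simp at hsum

end CycleObstruction

section PureSkeletons

variable {ι : Type*} {K : PreAbstractSimplicialComplex ι} {F : Finset ι} {d k : ℕ}

theorem IsPureOfDimension.isFacet_iff (h : IsPureOfDimension K d) :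
    IsFacet K F ↔ F ∈ K.faces ∧ F.card = d + 1 := by
  have card_le : ∀ s ∈ K.faces, s.card ≤ d + 1 := fun s hs => by
    have hpos := (K.isRelLowerSet_faces hs).1.card_pos
    have := h.1.2 ⟨s, hs, (Nat.sub_add_cancel hpos).symm⟩
    omega
  refine ⟨fun hF => ⟨hF.prop, (card_le F hF.prop).eq_of_not_lt fun hlt => ?_⟩,
    fun ⟨hF, hcard⟩ => ⟨hF, fun s hs hFs => ?_⟩⟩
  · obtain ⟨s, hs, hFs, hcard⟩ := h.2 F hF.prop hlt
    exact (Finset.card_le_card (hF.le_of_ge hs hFs)).not_gt (hcard ▸ hlt)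
  · exact (Finset.eq_of_subset_of_card_le hFs (hcard ▸ card_le s hs)).ge

theorem IsPureOfDimension.isShellable_iff [DecidableEq ι] (h : IsPureOfDimension K d) :
    IsShellable K ↔ IsShellableFamily {F | F ∈ K.faces ∧ F.card = d + 1} := by
  rw [isShellableFamily_iff_exists_fin]
  simp only [← h.isFacet_iff, Set.mem_ofPred_eq]
  exact and_iff_right (.inr ⟨d, h⟩)

theorem isPureOfDimension_skeleton [Finite ι] (hK : K.faces.Nonempty)
    (hd : ∀ F, IsFacet K F → d < F.card) : IsPureOfDimension (skeleton K d) d := by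
  have exists_superset : ∀ s ∈ K.faces, s.card ≤ d + 1 →
      ∃ t ∈ (skeleton K d).faces, s ⊆ t ∧ t.card = d + 1 := fun s hs hcard => by
    obtain ⟨F, hsF, hF⟩ := Finite.exists_le_maximal (p := (· ∈ K.faces)) hs
    obtain ⟨t, hst, htF, ht⟩ := Finset.exists_subsuperset_card_eq hsF hcard (hd F hF)
    have ht_mem := (K.isRelLowerSet_faces hF.prop).2 htF (Finset.card_pos.1 (by omega))
    exact ⟨t, ⟨ht_mem, ht.le⟩, hst, ht⟩
  refine ⟨⟨?_, ?_⟩, fun s hs hcard => exists_superset s hs.1 hcard.le⟩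
  · obtain ⟨s, hs⟩ := hK
    obtain ⟨v, hv⟩ := (K.isRelLowerSet_faces hs).1
    have hv_mem := (K.isRelLowerSet_faces hs).2 (Finset.singleton_subset_iff.2 hv)
      (Finset.singleton_nonempty v)
    obtain ⟨t, ht, -, hcard⟩ := exists_superset {v} hv_mem (by simp)
    exact ⟨t, ht, hcard⟩
  · rintro i ⟨s, hs, hi⟩
    have := hs.2
    omega

theorem IsFacet.lt_card_of_isPureOfDimension_skeleton (hF : IsFacet K F)
    (h : IsPureOfDimension (skeleton K k) d) : d < F.card := by
  by_contra! hcard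
  obtain ⟨s, hs, hs_card⟩ := h.1.1
  obtain ⟨t, ht, hFt, ht_card⟩ := h.2 F ⟨hF.prop, by have := hs.2; omega⟩ (by omega)
  have := Finset.card_le_card (hF.le_of_ge ht.1 hFt)
  omega

theorem IsFacet.maxPureSkeletonDim_add_one [Finite ι] (hF : IsFacet K F)
    (hmin : ∀ s, IsFacet K s → F.card ≤ s.card) : maxPureSkeletonDim K + 1 = F.card := by
  obtain ⟨⟨k, hk⟩, hmax⟩ := isGreatest_maxPureSkeletonDim K ⟨F, hF.prop⟩
  have hpos := (K.isRelLowerSet_faces hF.prop).1.card_pos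
  have hle : F.card - 1 ≤ maxPureSkeletonDim K :=
    hmax ⟨_, isPureOfDimension_skeleton ⟨F, hF.prop⟩ fun s hs => by have := hmin s hs; omega⟩
  have := hF.lt_card_of_isPureOfDimension_skeleton hk
  omega

end PureSkeletons

section DoubledCycle

open SimpleGraph

theorem exists_rel_of_transGen_self {V : Type*} {R : V → V → Prop} {y : V}
    (h : Relation.TransGen R y y) :
    (∃ a, R a y ∧ Relation.TransGen R a a) ∧ ∃ c, R y c ∧ Relation.TransGen R c c := by
  obtain ⟨a, hya, hay⟩ := Relation.TransGen.tail'_iff.1 h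
  obtain ⟨c, hyc, hcy⟩ := Relation.TransGen.head'_iff.1 h
  exact ⟨⟨a, hay, .head' hay hya⟩, c, hyc, .tail' hcy hyc⟩

variable {n : ℕ} [NeZero n] {x y : Fin (2 * n)} {S : Finset (Fin (2 * n))}
  {T : Finset (Fin n × Fin n)}

/-- A closed walk cannot visit the source `r`, so it would have to turn back at its vertex farthest
from `r` in the cyclic order. -/
theorem isAcyclic_of_subset_cycleGraph {E : Set (Fin n × Fin n)} {r : Fin n}
    (hn : 2 ≤ n) (hE : ∀ a b, (a, b) ∈ E → (cycleGraph n).Adj a b)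
    (hswap : ∀ a b, (a, b) ∈ E → (b, a) ∉ E) (hr : ∀ a, (a, r) ∉ E) : IsAcyclic E := by
  intro x hx
  obtain ⟨y, hy, hmax⟩ := Set.exists_max_image _ (fun y : Fin n => (y - r).val)
    (Set.toFinite {y | Relation.TransGen (fun a b => (a, b) ∈ E) y y}) ⟨x, hx⟩
  have ne_source : ∀ z, Relation.TransGen (fun a b => (a, b) ∈ E) z z → z ≠ r := by
    rintro z hz rfl
    obtain ⟨⟨a, ha, -⟩, -⟩ := exists_rel_of_transGen_self hz
    exact hr a ha
  have ne_add_one : ∀ z, Relation.TransGen (fun a b => (a, b) ∈ E) z z → z ≠ y + 1 := by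
    rintro z hz rfl
    have hle : (y + 1 - r).val ≤ (y - r).val := hmax _ hz
    have hne : (y + 1 - r).val ≠ 0 :=
      (Fin.val_ne_zero_iff).2 (sub_ne_zero.2 (ne_source _ hz))
    rw [add_sub_right_comm, val_add_one_eq_ite hn] at hle hne
    split_ifs at hle hne <;> omega
  obtain ⟨⟨a, hay, ha⟩, c, hyc, hc⟩ := exists_rel_of_transGen_self hy
  have ha_eq : y = a + 1 :=
    ((cycleGraph_adj_iff_eq_add_one hn).1 (hE a y hay)).resolve_right (ne_add_one a ha)
  have hc_eq : y = c + 1 :=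
    ((cycleGraph_adj_iff_eq_add_one hn).1 (hE y c hyc)).resolve_left (ne_add_one c hc)
  rw [← add_right_cancel (ha_eq.symm.trans hc_eq)] at hyc
  exact hswap a y hay hyc

/-- The arcs of the doubled cycle in an order in which cyclically consecutive ones have the same
head or are opposite: `2j ↦ (j + 1, j)` and `2j + 1 ↦ (j, j + 1)`. -/
def cycleArc (n : ℕ) [NeZero n] (x : Fin (2 * n)) : Fin n × Fin n :=
  let j : Fin n := ⟨x / 2, by omega⟩
  if x.val % 2 = 0 then (j + 1, j) else (j, j + 1)

theorem val_cycleArc_fst (hn : 2 ≤ n) (x : Fin (2 * n)) : ((cycleArc n x).1 : ℕ) =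
    if x.val % 2 = 0 then if x.val / 2 + 1 = n then 0 else x.val / 2 + 1 else x.val / 2 := by
  rw [cycleArc, apply_ite Prod.fst, apply_ite Fin.val, val_add_one_eq_ite hn]

theorem val_cycleArc_snd (hn : 2 ≤ n) (x : Fin (2 * n)) : ((cycleArc n x).2 : ℕ) =
    if x.val % 2 = 0 then x.val / 2 else if x.val / 2 + 1 = n then 0 else x.val / 2 + 1 := by
  rw [cycleArc, apply_ite Prod.snd, apply_ite Fin.val, val_add_one_eq_ite hn]

theorem cycleArc_injective (hn : 3 ≤ n) : Function.Injective (cycleArc n) := by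
  intro x y h
  simp only [Prod.ext_iff, Fin.ext_iff, val_cycleArc_fst (show 2 ≤ n by omega),
    val_cycleArc_snd (show 2 ≤ n by omega)] at h ⊢
  split_ifs at h <;> omega

theorem cycleGraph_adj_iff_cycleArc (hn : 3 ≤ n) :
    (cycleGraph (2 * n)).Adj x y ↔
      x ≠ y ∧ ((cycleArc n x).2 = (cycleArc n y).2 ∨ cycleArc n x = (cycleArc n y).swap) := by
  simp only [cycleGraph_adj_iff_val (show 2 ≤ 2 * n by omega), ne_eq, Prod.ext_iff, Prod.fst_swap,
    Prod.snd_swap, Fin.ext_iff, val_cycleArc_fst (show 2 ≤ n by omega),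
    val_cycleArc_snd (show 2 ≤ n by omega)]
  grind

theorem exists_cycleArc_eq_iff (hn : 2 ≤ n) {a b : Fin n} :
    (∃ x, cycleArc n x = (a, b)) ↔ (cycleGraph n).Adj a b := by
  rw [cycleGraph_adj_iff_eq_add_one hn]
  constructor
  · rintro ⟨x, hx⟩
    grind [cycleArc]
  · rintro (rfl | rfl)
    · exact ⟨⟨2 * a + 1, by omega⟩, by grind [cycleArc]⟩
    · exact ⟨⟨2 * b, by omega⟩, by grind [cycleArc]⟩

/-- The arcs of the doubled cycle, as an embedding of the vertices of the cycle of length `2n`. -/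
def cycleArcEmbedding (hn : 3 ≤ n) : Fin (2 * n) ↪ Fin n × Fin n :=
  ⟨cycleArc n, cycleArc_injective hn⟩

theorem mem_map_cycleArcEmbedding (hn : 3 ≤ n) {e : Fin n × Fin n} :
    e ∈ S.map (cycleArcEmbedding hn) ↔ ∃ x ∈ S, cycleArc n x = e :=
  Finset.mem_map

theorem isIndepSet_cycleGraph_iff_map_cycleArc (hn : 3 ≤ n) :
    (cycleGraph (2 * n)).IsIndepSet S ↔
      (∀ a a' b, (a, b) ∈ S.map (cycleArcEmbedding hn) →
        (a', b) ∈ S.map (cycleArcEmbedding hn) → a = a') ∧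
      ∀ a b, (a, b) ∈ S.map (cycleArcEmbedding hn) →
        (b, a) ∉ S.map (cycleArcEmbedding hn) := by
  simp only [mem_map_cycleArcEmbedding]
  constructor
  · intro hS
    have eq_of_adj : ∀ x ∈ S, ∀ y ∈ S,
        (cycleArc n x).2 = (cycleArc n y).2 ∨ cycleArc n x = (cycleArc n y).swap → x = y :=
      fun x hx y hy h => of_not_not fun hxy =>
        hS hx hy hxy ((cycleGraph_adj_iff_cycleArc hn).2 ⟨hxy, h⟩)
    refine ⟨?_, ?_⟩
    · rintro a a' b ⟨x, hx, hxa⟩ ⟨y, hy, hya⟩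
      obtain rfl := eq_of_adj x hx y hy (.inl (by rw [hxa, hya]))
      exact congrArg Prod.fst (hxa.symm.trans hya)
    · rintro a b ⟨x, hx, hxa⟩ ⟨y, hy, hya⟩
      obtain rfl := eq_of_adj x hx y hy (.inr (by rw [hxa, hya, Prod.swap_prod_mk]))
      have hab := (exists_cycleArc_eq_iff (by omega)).1 ⟨x, hxa⟩
      exact hab.ne (congrArg Prod.fst (hxa.symm.trans hya))
  · rintro ⟨hhead, hswap⟩ x hx y hy hxy hadj
    rcases ((cycleGraph_adj_iff_cycleArc hn).1 hadj).2 with h | h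
    · exact hxy (cycleArc_injective hn (Prod.ext
        (hhead _ _ _ ⟨x, hx, rfl⟩ ⟨y, hy, Prod.ext rfl h.symm⟩) h))
    · exact hswap _ _ ⟨y, hy, rfl⟩ ⟨x, hx, h⟩

/-- The complex of directed trees of the doubled cycle. -/
abbrev cycleComplex (n : ℕ) : PreAbstractSimplicialComplex (Fin n × Fin n) :=
  directedTreeComplex (doubleDigraph (cycleGraph n))

theorem exists_map_cycleArc_eq_of_mem_faces (hn : 3 ≤ n) (hT : T ∈ (cycleComplex n).faces) :
    ∃ S : Finset (Fin (2 * n)), (cycleGraph (2 * n)).IsIndepSet S ∧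
      S.map (cycleArcEmbedding hn) = T := by
  obtain ⟨-, hadj, hforest⟩ := hT
  obtain ⟨hacyclic, hhead⟩ := isDirectedForest_iff.1 hforest
  obtain ⟨S, -, rfl⟩ : ∃ S ⊆ Finset.univ, S.map (cycleArcEmbedding hn) = T := by
    simp_rw [eq_comm (b := T)]
    refine Finset.subset_map_iff.1 fun e he => (mem_map_cycleArcEmbedding hn).2 ?_
    obtain ⟨x, hx⟩ := (exists_cycleArc_eq_iff (by omega)).2 (hadj e he)
    exact ⟨x, Finset.mem_univ x, hx⟩
  exact ⟨S, (isIndepSet_cycleGraph_iff_map_cycleArc hn).2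
    ⟨hhead, fun a b hab hba => hacyclic a (.tail (.single hab) hba)⟩, rfl⟩

theorem map_cycleArc_mem_faces (hn : 3 ≤ n) (hS : (cycleGraph (2 * n)).IsIndepSet S)
    (hpos : 0 < S.card) (hcard : S.card < n) :
    S.map (cycleArcEmbedding hn) ∈ (cycleComplex n).faces := by
  obtain ⟨hhead, hswap⟩ := (isIndepSet_cycleGraph_iff_map_cycleArc hn).1 hS
  have hadj : ∀ a b, (a, b) ∈ S.map (cycleArcEmbedding hn) → (cycleGraph n).Adj a b :=
    fun a b hab => by
      obtain ⟨x, -, hx⟩ := (mem_map_cycleArcEmbedding hn).1 hab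
      exact (exists_cycleArc_eq_iff (by omega)).1 ⟨x, hx⟩
  obtain ⟨r, -, hr⟩ : ∃ r ∈ Finset.univ, r ∉ S.image fun x => (cycleArc n x).2 :=
    Finset.exists_mem_notMem_of_card_lt_card <| Finset.card_image_le.trans_lt <| by
      rwa [Finset.card_univ, Fintype.card_fin]
  have hr_source : ∀ a, (a, r) ∉ S.map (cycleArcEmbedding hn) := fun a ha => by
    obtain ⟨x, hx, hxr⟩ := (mem_map_cycleArcEmbedding hn).1 ha
    exact hr (Finset.mem_image.2 ⟨x, hx, congrArg Prod.snd hxr⟩)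
  exact ⟨(Finset.card_pos.1 hpos).map, fun e => hadj e.1 e.2, isDirectedForest_iff.2
    ⟨isAcyclic_of_subset_cycleGraph (by omega) hadj hswap hr_source, hhead⟩⟩

theorem setOf_mem_faces_card_eq_image_map_indepSets (hn : 3 ≤ n) {m : ℕ} (hm : m + 1 < n) :
    {F | F ∈ (skeleton (cycleComplex n) m).faces ∧ F.card = m + 1} =
      Finset.map (cycleArcEmbedding hn) ''
        indepSets (cycleGraph (2 * n)) Finset.univ (m + 1) := by
  ext T
  constructor
  · rintro ⟨⟨hT, -⟩, hcard⟩
    obtain ⟨S, hS, rfl⟩ := exists_map_cycleArc_eq_of_mem_faces hn hT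
    exact ⟨S, ⟨Finset.subset_univ S, hS, (Finset.card_map _).symm.trans hcard⟩, rfl⟩
  · rintro ⟨S, ⟨-, hS, hcard⟩, rfl⟩
    have hmap : (S.map (cycleArcEmbedding hn)).card = m + 1 := (Finset.card_map _).trans hcard
    exact ⟨⟨map_cycleArc_mem_faces hn hS (by omega) (by omega), hmap.le⟩, hmap⟩

theorem le_card_of_isFacet_cycleComplex (hn : 3 ≤ n) (hT : IsFacet (cycleComplex n) T) :
    2 * n ≤ 3 * T.card := by
  obtain ⟨S, hS, rfl⟩ := exists_map_cycleArc_eq_of_mem_faces hn hT.prop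
  rw [Finset.card_map]
  by_contra! hcard
  obtain ⟨w, hwS, -, hw⟩ := exists_insert_isIndepSet_of_degree_le (T := ∅)
    (cycleGraph_degree_le_two (show 2 ≤ 2 * n by omega)) hS
    (by rwa [Finset.card_empty, Fintype.card_fin])
  have hinsert := Finset.card_insert_of_notMem hwS
  have hle := hT.le_of_ge (map_cycleArc_mem_faces hn hw (by omega) (by omega))
    (Finset.map_subset_map.2 (Finset.subset_insert w S))
  exact hwS (Finset.map_subset_map.1 hle (Finset.mem_insert_self w S))

theorem exists_isFacet_cycleComplex (hn : 3 ≤ n) :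
    ∃ T, IsFacet (cycleComplex n) T ∧ T.card = (2 * n + 2) / 3 := by
  obtain ⟨S, hcard, hS⟩ := exists_maximal_isIndepSet_cycleGraph (show 2 ≤ 2 * n by omega)
  refine ⟨S.map (cycleArcEmbedding hn),
    ⟨map_cycleArc_mem_faces hn hS.prop (by omega) (by omega), fun T hT hle => ?_⟩,
    (Finset.card_map _).trans hcard⟩
  obtain ⟨S', hS', rfl⟩ := exists_map_cycleArc_eq_of_mem_faces hn hT
  exact Finset.map_subset_map.2 (hS.le_of_ge hS' (Finset.map_subset_map.1 hle))

theorem maxPureSkeletonDim_cycleComplex_add_one (hn : 3 ≤ n) :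
    maxPureSkeletonDim (cycleComplex n) + 1 = (2 * n + 2) / 3 := by
  obtain ⟨T, hT, hcard⟩ := exists_isFacet_cycleComplex hn
  rw [hT.maxPureSkeletonDim_add_one fun S hS => ?_, hcard]
  have := le_card_of_isFacet_cycleComplex hn hS
  omega

theorem isShellable_skeleton_cycleComplex_iff (hn : 3 ≤ n) :
    IsShellable (skeleton (cycleComplex n) (maxPureSkeletonDim (cycleComplex n))) ↔
      IsShellableFamily (indepSets (cycleGraph (2 * n)) Finset.univ ((2 * n + 2) / 3)) := by
  have hm := maxPureSkeletonDim_cycleComplex_add_one hn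
  obtain ⟨T, hT, -⟩ := exists_isFacet_cycleComplex hn
  have hpure : IsPureOfDimension (skeleton (cycleComplex n) (maxPureSkeletonDim (cycleComplex n)))
      (maxPureSkeletonDim (cycleComplex n)) :=
    isPureOfDimension_skeleton ⟨T, hT.prop⟩ fun S hS => by
      have := le_card_of_isFacet_cycleComplex hn hS
      omega
  rw [hpure.isShellable_iff, setOf_mem_faces_card_eq_image_map_indepSets hn (by omega), hm]
  exact isShellableFamily_image_map_iff

end DoubledCycle

theorem isShellableFamily_indepSets_cycleGraph_iff {n : ℕ} (hn : 2 ≤ n) :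
    IsShellableFamily (indepSets (SimpleGraph.cycleGraph n) Finset.univ ((n + 2) / 3)) ↔
      n % 3 ≠ 1 := by
  refine ⟨fun h hn_mod => ?_, fun hn_mod => ?_⟩
  · obtain ⟨t, rfl⟩ : ∃ t, n = 3 * t + 1 := ⟨n / 3, by omega⟩
    rw [show (3 * t + 1 + 2) / 3 = t + 1 by omega] at h
    exact not_isShellableFamily_indepSets_cycleGraph (by omega) h
  · obtain ⟨t, ht⟩ : ∃ t, (n + 2) / 3 = t + 1 := Nat.exists_eq_add_one.2 (by omega)
    rw [ht]
    exact isShellableFamily_indepSets_cycleGraph (by omega)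

end TreeComplex

theorem mainTheorem5 (n : ℕ) (hn : 3 ≤ n) :
    TreeComplex.IsShellable
        (TreeComplex.skeleton
          (TreeComplex.directedTreeComplex
            (TreeComplex.doubleDigraph (SimpleGraph.cycleGraph n)))
          (TreeComplex.maxPureSkeletonDim
            (TreeComplex.directedTreeComplex
              (TreeComplex.doubleDigraph (SimpleGraph.cycleGraph n))))) ↔
      ∃ k : ℕ, n = 3 * k ∨ n = 3 * k + 1 := by
  have : NeZero n := ⟨by omega⟩
  rw [TreeComplex.isShellable_skeleton_cycleComplex_iff hn,
    TreeComplex.isShellableFamily_indepSets_cycleGraph_iff (by omega)]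
  exact ⟨fun h => ⟨n / 3, by omega⟩, by rintro ⟨k, rfl | rfl⟩ <;> omega⟩
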